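/- Let $n\ge 2$, let $\Omega\subset\mathbb{R}^n$ be a bounded domain (a nonempty, bounded, connected open set) with boundary $\Gamma$, and let $u\in C^2(\Omega)$ be a real-valued harmonic function, that is, $\Delta u=\sum_{i=1}^n\partial_i^2u=0$ in $\Omega$. Write $B(\xi,r)$ for the open ball of centre $\xi$ and radius $r$. (i) (Doubling inequality) Let $\xi\in\Omega$ and $0<\overline r<\operatorname{dist}(\xi,\Gamma)$. There exists a constant $C>0$, depending on $u$, $\xi$ and $\overline r$, such that, for every $0<r\le\overline r/2$, $$\|u\|_{L^2(B(\xi,2r))}\le C\,\|u\|_{L^2(B(\xi,r))}.$$ (ii) (Strong unique continuation) Let $\xi\in\Omega$. If $u$ vanishes of infinite order at $\xi$, that is, if for every $N\in\mathbb{N}$ $$\int_{B(\xi,r)}u(x)^2\,dx=O(r^N)\quad\text{as } r\to0^+,$$ then $u=0$ in $\Omega$. -/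

import Mathlib

open Set Filter Topology MeasureTheory Asymptotics

/-- The square mass `K(r) = ∫_{B(ξ,r)} u²` of `u` over the open ball of centre `ξ` and
radius `r` in `ℝⁿ`. -/
noncomputable def ballSquareMass {n : ℕ} (u : EuclideanSpace ℝ (Fin n) → ℝ)
    (ξ : EuclideanSpace ℝ (Fin n)) (r : ℝ) : ℝ :=
  ∫ x in Metric.ball ξ r, u x ^ 2

/-- `u` vanishes of infinite order at `ξ`: `K(r) = O(r ^ N)` as `r → 0⁺`, for every
natural number `N`. -/
def VanishesOfInfiniteOrderAt {n : ℕ} (u : EuclideanSpace ℝ (Fin n) → ℝ)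
    (ξ : EuclideanSpace ℝ (Fin n)) : Prop :=
  ∀ N : ℕ, (fun r : ℝ => ballSquareMass u ξ r) =O[𝓝[>] (0 : ℝ)] (fun r : ℝ => r ^ N)

/-! The argument is a weighted logarithmic convexity. Let `w y = max 0 (1 - ‖y‖²)` and let `P(s,t)`
be the integral over the unit ball of `w(y) u(ξ+sy) u(ξ+ty)`. For `f`, `g` harmonic near the closed
unit ball, the divergence of `w²(g∇f - f∇g)` is `-4w(g y·∇f - f y·∇g)`, so the latter integrates to
zero. Applied to two dilates of `u`, this says that `s ↦ P(s, p/s)` has zero derivative, so `P(s,t)`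
depends only on `st` (`dilationPairing_eq_of_mul_eq`).

Hence `P(2r,2r) = P(r,4r)`, and Cauchy–Schwarz gives `h(2r)² ≤ h(r) h(4r)` for `h(r) = P(r,r)`
(`dilationPairing_two_mul_sq_le`). Where `h > 0`, the ratio `h(2r)/h(r)` is therefore bounded by its
value one dyadic scale up, hence by its value near the top scale. Comparing `h` with the unweighted
mass turns this into the doubling inequality. The same inequality propagates zeros outward, which
gives weak unique continuation and disposes of the case where the mass vanishes at some radius.
Strong unique continuation follows by iterating doubling down to scale `ρ/2^k`: decay of order `N`
with `2^N > C` beats the loss `C^k`. -/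

theorem hasDerivAt_max_zero_sq (x : ℝ) :
    HasDerivAt (fun t : ℝ => max 0 t ^ 2) (2 * max 0 x) x := by
  rcases lt_trichotomy x 0 with h | rfl | h
  · have : (fun t : ℝ => max 0 t ^ 2) =ᶠ[𝓝 x] fun _ => 0 := by
      filter_upwards [Iio_mem_nhds h] with t ht
      simp [max_eq_left (le_of_lt (mem_Iio.1 ht))]
    simpa [max_eq_left h.le] using (hasDerivAt_const x (0 : ℝ)).congr_of_eventuallyEq this
  · rw [hasDerivAt_iff_isLittleO_nhds_zero]
    have h1 : (fun t : ℝ => t ^ 2) =o[𝓝 0] fun t : ℝ => t := by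
      simpa using isLittleO_pow_pow (𝕜 := ℝ) (m := 1) (n := 2) (by norm_num)
    refine IsBigO.trans_isLittleO (IsBigO.of_bound 1 (Eventually.of_forall fun t => ?_)) h1
    rcases le_total 0 t with ht | ht <;> simp [ht, sq_nonneg]
  · have : (fun t : ℝ => max 0 t ^ 2) =ᶠ[𝓝 x] fun t => t ^ 2 := by
      filter_upwards [Ioi_mem_nhds h] with t ht
      simp [max_eq_right (le_of_lt (mem_Ioi.1 ht))]
    simpa [max_eq_right h.le] using (hasDerivAt_pow 2 x).congr_of_eventuallyEq this

/-- Squaring removes the corner of `max 0 t`; one continuous derivative is all that the divergence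
theorem below needs. -/
theorem contDiff_max_zero_sq : ContDiff ℝ 1 (fun t : ℝ => max 0 t ^ 2) := by
  rw [contDiff_one_iff_deriv]
  refine ⟨fun x => (hasDerivAt_max_zero_sq x).differentiableAt, ?_⟩
  rw [show deriv (fun t : ℝ => max 0 t ^ 2) = fun x => 2 * max 0 x from
    funext fun x => (hasDerivAt_max_zero_sq x).deriv]
  fun_prop

/-- A compactly supported radial weight on the unit ball. -/
noncomputable def unitBallWeight {E : Type*} [NormedAddCommGroup E] (y : E) : ℝ := max 0 (1 - ‖y‖ ^ 2)

section Weight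

variable {E : Type*} [NormedAddCommGroup E]

theorem unitBallWeight_nonneg (y : E) : 0 ≤ unitBallWeight y := le_max_left _ _

theorem continuous_unitBallWeight : Continuous (unitBallWeight : E → ℝ) := by
  unfold unitBallWeight; fun_prop

theorem unitBallWeight_eq_zero {y : E} (hy : 1 ≤ ‖y‖) : unitBallWeight y = 0 :=
  max_eq_left (by nlinarith)

variable [InnerProductSpace ℝ E]

theorem contDiff_unitBallWeight_sq : ContDiff ℝ 1 (fun y : E => unitBallWeight y ^ 2) :=
  contDiff_max_zero_sq.comp (contDiff_const.sub (contDiff_norm_sq ℝ))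

theorem hasFDerivAt_unitBallWeight_sq (y : E) :
    HasFDerivAt (fun y : E => unitBallWeight y ^ 2)
      ((-4 * unitBallWeight y) • innerSL ℝ y) y := by
  have h := (hasDerivAt_max_zero_sq (1 - ‖y‖ ^ 2)).comp_hasFDerivAt y
    ((hasStrictFDerivAt_norm_sq y).hasFDerivAt.const_sub 1)
  refine h.congr_fderiv ?_
  ext z
  simp [unitBallWeight]
  ring

theorem laplacian_eq_sum_fderiv_fderiv [FiniteDimensional ℝ E] (f : E → ℝ) (x : E) :
    Laplacian.laplacian f x = ∑ i, fderiv ℝ (fderiv ℝ f) x (stdOrthonormalBasis ℝ E i)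
      (stdOrthonormalBasis ℝ E i) := by
  rw [InnerProductSpace.laplacian_eq_iteratedFDeriv_stdOrthonormalBasis]
  simp [iteratedFDeriv_two_apply]

end Weight

/-! ### Green's identity with a compactly supported weight -/

section Green

variable {E : Type*} [NormedAddCommGroup E] [InnerProductSpace ℝ E] [FiniteDimensional ℝ E]
  [MeasurableSpace E] [BorelSpace E]

/-- Integration by parts against the constant `1`. -/
theorem integral_fderiv_apply_eq_zero {f : E → ℝ} (hf : ContDiff ℝ 1 f)
    (hc : HasCompactSupport f) (v : E) : ∫ x, fderiv ℝ f x v = 0 := by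
  have hd : Continuous fun x => fderiv ℝ f x v :=
    (hf.continuous_fderiv one_ne_zero).clm_apply continuous_const
  have hi : Integrable (fun x => fderiv ℝ f x v) :=
    hd.integrable_of_hasCompactSupport (hc.fderiv_apply (𝕜 := ℝ) v)
  have := integral_mul_fderiv_eq_neg_fderiv_mul_of_integrable (μ := (volume : Measure E))
    (f := fun _ => (1 : ℝ)) (g := f) (v := v) (by simp) (by simpa using hi)
    (by simpa using hf.continuous.integrable_of_hasCompactSupport hc)
    (fun x _ => differentiableAt_const _) (fun x _ => (hf.differentiable one_ne_zero) x)
  simpa using this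

/-- Green's second identity for the square of `unitBallWeight`. -/
theorem integral_unitBallWeight_mul_radial_eq_zero {f g : E → ℝ} {ρ : ℝ} (hρ : 1 < ρ)
    (hf : InnerProductSpace.HarmonicOnNhd f (Metric.ball 0 ρ))
    (hg : InnerProductSpace.HarmonicOnNhd g (Metric.ball 0 ρ)) :
    ∫ y in Metric.closedBall (0 : E) 1,
      unitBallWeight y * (g y * fderiv ℝ f y y - f y * fderiv ℝ g y y) = 0 := by
  set b := stdOrthonormalBasis ℝ E
  let X : Fin (Module.finrank ℝ E) → E → ℝ := fun i y =>
    g y * fderiv ℝ f y (b i) - f y * fderiv ℝ g y (b i)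
  -- Components of `w²(g∇f - f∇g)`. The factor `w²` kills the field outside the unit ball, so it is
  -- globally `C¹` although `f` and `g` are controlled only on the ball of radius `ρ > 1`.
  let V : Fin (Module.finrank ℝ E) → E → ℝ := fun i y => unitBallWeight y ^ 2 * X i y
  have hXc : ∀ i, ∀ y ∈ Metric.ball (0 : E) ρ, ContDiffAt ℝ 1 (X i) y := by
    intro i y hy
    have h1 : ContDiffAt ℝ 1 (fderiv ℝ f) y := (hf y hy).1.fderiv_right (by norm_num)
    have h2 : ContDiffAt ℝ 1 (fderiv ℝ g) y := (hg y hy).1.fderiv_right (by norm_num)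
    have h3 : ContDiffAt ℝ 1 f y := (hf y hy).1.of_le (by norm_num)
    have h4 : ContDiffAt ℝ 1 g y := (hg y hy).1.of_le (by norm_num)
    exact (h4.mul (h1.clm_apply contDiffAt_const)).sub (h3.mul (h2.clm_apply contDiffAt_const))
  have hV0 : ∀ i, ∀ y : E, 1 < ‖y‖ → V i =ᶠ[𝓝 y] fun _ => 0 := by
    intro i y hy
    filter_upwards [(isOpen_lt continuous_const continuous_norm).mem_nhds hy] with z hz
    simp [V, unitBallWeight_eq_zero (le_of_lt hz)]
  have hVc : ∀ i, ContDiff ℝ 1 (V i) := by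
    intro i
    rw [contDiff_iff_contDiffAt]
    intro y
    rcases lt_or_ge 1 ‖y‖ with hy | hy
    · exact contDiffAt_const.congr_of_eventuallyEq (hV0 i y hy)
    · exact contDiff_unitBallWeight_sq.contDiffAt.mul (hXc i y (by simp; linarith))
  have hVs : ∀ i, HasCompactSupport (V i) := fun i =>
    HasCompactSupport.intro (isCompact_closedBall 0 1) fun y hy => by
      simp only [Metric.mem_closedBall, dist_zero_right, not_le] at hy
      exact (hV0 i y hy).eq_of_nhds
  have hint : ∀ i, Integrable (fun y => fderiv ℝ (V i) y (b i)) := fun i =>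
    (((hVc i).continuous_fderiv one_ne_zero).clm_apply
      continuous_const).integrable_of_hasCompactSupport ((hVs i).fderiv_apply (𝕜 := ℝ) (b i))
  have hzero : ∫ y, ∑ i, fderiv ℝ (V i) y (b i) = 0 := by
    rw [integral_finsetSum _ fun i _ => hint i]
    exact Finset.sum_eq_zero fun i _ => integral_fderiv_apply_eq_zero (hVc i) (hVs i) (b i)
  -- Harmonicity cancels the second-order terms; only `∇(w²) = -4wy` contributes.
  have hdiv : ∀ y ∈ Metric.closedBall (0 : E) 1, ∑ i, fderiv ℝ (V i) y (b i) =
      -4 * (unitBallWeight y * (g y * fderiv ℝ f y y - f y * fderiv ℝ g y y)) := by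
    intro y hy
    have hyρ : y ∈ Metric.ball (0 : E) ρ := Metric.closedBall_subset_ball hρ hy
    have hXd : ∀ i, fderiv ℝ (X i) y (b i) =
        g y * fderiv ℝ (fderiv ℝ f) y (b i) (b i) - f y * fderiv ℝ (fderiv ℝ g) y (b i) (b i) := by
      intro i
      have h1 : HasFDerivAt (fderiv ℝ f) (fderiv ℝ (fderiv ℝ f) y) y :=
        (((hf y hyρ).1.fderiv_right (m := 1) (by norm_num)).differentiableAt
          one_ne_zero).hasFDerivAt
      have h2 : HasFDerivAt (fderiv ℝ g) (fderiv ℝ (fderiv ℝ g) y) y :=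
        (((hg y hyρ).1.fderiv_right (m := 1) (by norm_num)).differentiableAt
          one_ne_zero).hasFDerivAt
      have h3 := ((hf y hyρ).1.differentiableAt two_ne_zero).hasFDerivAt
      have h4 := ((hg y hyρ).1.differentiableAt two_ne_zero).hasFDerivAt
      have := (h4.mul (h1.clm_apply (hasFDerivAt_const (b i) y))).sub
        (h3.mul (h2.clm_apply (hasFDerivAt_const (b i) y)))
      rw [show fderiv ℝ (X i) y = _ from this.fderiv]
      simp
      ring
    have hVd : ∀ i, fderiv ℝ (V i) y (b i) = unitBallWeight y ^ 2 * fderiv ℝ (X i) y (b i) +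
        (-4 * unitBallWeight y) * (inner ℝ y (b i) * X i y) := by
      intro i
      have := (hasFDerivAt_unitBallWeight_sq y).mul
        ((hXc i y hyρ).differentiableAt one_ne_zero).hasFDerivAt
      rw [show fderiv ℝ (V i) y = _ from this.fderiv]
      simp
      ring
    have hexp : ∀ L : E →L[ℝ] ℝ, ∑ i, inner ℝ y (b i) * L (b i) = L y := by
      intro L
      conv_rhs => rw [← b.sum_repr' y]
      simp [real_inner_comm]
    have hlf : ∑ i, fderiv ℝ (fderiv ℝ f) y (b i) (b i) = 0 := by
      rw [← laplacian_eq_sum_fderiv_fderiv]; exact (hf y hyρ).2.eq_of_nhds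
    have hlg : ∑ i, fderiv ℝ (fderiv ℝ g) y (b i) (b i) = 0 := by
      rw [← laplacian_eq_sum_fderiv_fderiv]; exact (hg y hyρ).2.eq_of_nhds
    simp_rw [hVd, hXd]
    have hX : ∑ i, inner ℝ y (b i) * X i y = g y * fderiv ℝ f y y - f y * fderiv ℝ g y y := by
      rw [← hexp (fderiv ℝ f y), ← hexp (fderiv ℝ g y), Finset.mul_sum, Finset.mul_sum,
        ← Finset.sum_sub_distrib]
      exact Finset.sum_congr rfl fun i _ => by simp only [X]; ring
    rw [Finset.sum_add_distrib, ← Finset.mul_sum, ← Finset.mul_sum, Finset.sum_sub_distrib,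
      ← Finset.mul_sum, ← Finset.mul_sum, hlf, hlg, hX]
    ring
  have hout : ∀ y ∉ Metric.closedBall (0 : E) 1, ∑ i, fderiv ℝ (V i) y (b i) = 0 := by
    intro y hy
    simp only [Metric.mem_closedBall, dist_zero_right, not_le] at hy
    refine Finset.sum_eq_zero fun i _ => ?_
    rw [(hV0 i y hy).fderiv_eq]
    simp
  rw [← setIntegral_eq_integral_of_forall_compl_eq_zero hout,
    setIntegral_congr_fun Metric.isClosed_closedBall.measurableSet hdiv,
    integral_const_mul] at hzero
  simpa using hzero

theorem hasDerivAt_setIntegral_of_isCompact {K : Set E} (hK : IsCompact K) {S : Set ℝ}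
    (hS : IsOpen S) {F F' : ℝ → E → ℝ} (hF : ∀ s ∈ S, ContinuousOn (F s) K)
    (hF' : ContinuousOn (Function.uncurry F') (S ×ˢ K))
    (hd : ∀ s ∈ S, ∀ y ∈ K, HasDerivAt (fun t => F t y) (F' s y) s) {s : ℝ} (hs : s ∈ S) :
    HasDerivAt (fun t => ∫ y in K, F t y) (∫ y in K, F' s y) s := by
  obtain ⟨ε, hε, hεS⟩ := Metric.nhds_basis_closedBall.mem_iff.1 (hS.mem_nhds hs)
  obtain ⟨M, hM⟩ := ((isCompact_closedBall s ε).prod hK).exists_bound_of_continuousOn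
    (hF'.mono (prod_mono hεS subset_rfl))
  have hKm := hK.isClosed.measurableSet
  refine (hasDerivAt_integral_of_dominated_loc_of_deriv_le (bound := fun _ => M)
    (Metric.closedBall_mem_nhds s hε) ?_ ((hF s hs).integrableOn_compact hK) ?_ ?_ ?_ ?_).2
  · filter_upwards [hS.mem_nhds hs] with t ht
    exact (hF t ht).aestronglyMeasurable hKm
  · refine ContinuousOn.aestronglyMeasurable ?_ hKm
    exact hF'.comp (f := fun y => (s, y)) (by fun_prop) fun y hy => ⟨hs, hy⟩
  · filter_upwards [ae_restrict_mem hKm] with y hy t ht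
    exact hM (t, y) ⟨ht, hy⟩
  · exact integrableOn_const (hK.measure_lt_top.ne)
  · filter_upwards [ae_restrict_mem hKm] with y hy t ht
    exact hd t (hεS ht) y hy

end Green

/-! ### Pairing of dilates and logarithmic convexity -/

section Pairing

variable {E : Type*} [NormedAddCommGroup E] [InnerProductSpace ℝ E]

theorem fderiv_comp_add_smul {F : Type*} [NormedAddCommGroup F] [NormedSpace ℝ F] (f : E → F)
    (ξ : E) (s : ℝ) (y : E) :
    fderiv ℝ (fun z => f (ξ + s • z)) y = s • fderiv ℝ f (ξ + s • y) := by
  rw [fderiv_comp_smul (f := fun z => f (ξ + z)), fderiv_comp_add_left]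

theorem add_smul_mem_ball {ξ y : E} {s R : ℝ} (hs : 0 ≤ s) (hsR : s < R) (hy : ‖y‖ ≤ 1) :
    ξ + s • y ∈ Metric.ball ξ R := by
  rw [Metric.mem_ball, dist_eq_norm, add_sub_cancel_left, norm_smul, Real.norm_of_nonneg hs]
  nlinarith [norm_nonneg y]

variable {u : E → ℝ} {ξ : E} {R : ℝ}

theorem ContinuousOn.comp_add_smul_closedBall {F : Type*} [TopologicalSpace F] {f : E → F}
    (hf : ContinuousOn f (Metric.ball ξ R)) {s : ℝ} (hs : 0 ≤ s) (hsR : s < R) :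
    ContinuousOn (fun y => f (ξ + s • y)) (Metric.closedBall 0 1) :=
  hf.comp (by fun_prop) fun y hy => add_smul_mem_ball hs hsR (by simpa using hy)

theorem continuousOn_dilationPairing_integrand (hu : ContinuousOn u (Metric.ball ξ R)) {s t : ℝ}
    (hs : 0 ≤ s) (hsR : s < R) (ht : 0 ≤ t) (htR : t < R) :
    ContinuousOn (fun y => unitBallWeight y * (u (ξ + s • y) * u (ξ + t • y)))
      (Metric.closedBall 0 1) :=
  continuous_unitBallWeight.continuousOn.mul
    ((hu.comp_add_smul_closedBall hs hsR).mul (hu.comp_add_smul_closedBall ht htR))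

variable [FiniteDimensional ℝ E]

theorem InnerProductSpace.HarmonicAt.comp_add_smul {f : E → ℝ} {ξ : E} {s : ℝ} {y : E}
    (hf : InnerProductSpace.HarmonicAt f (ξ + s • y)) :
    InnerProductSpace.HarmonicAt (fun z => f (ξ + s • z)) y := by
  have hc : Continuous fun z : E => ξ + s • z := by fun_prop
  refine ⟨ContDiffAt.comp (g := f) y hf.1 (by fun_prop), ?_⟩
  filter_upwards [hc.continuousAt.eventually hf.2] with z hz
  rw [Pi.zero_apply, laplacian_eq_sum_fderiv_fderiv] at hz ⊢
  have h1 : fderiv ℝ (fun z => f (ξ + s • z)) = s • fun y => fderiv ℝ f (ξ + s • y) :=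
    funext (fderiv_comp_add_smul f ξ s)
  have h2 : fderiv ℝ (fderiv ℝ fun z => f (ξ + s • z)) z =
      s • s • fderiv ℝ (fderiv ℝ f) (ξ + s • z) := by
    have h3 := congrFun (fderiv_const_smul_field (𝕜 := ℝ) (f := fun y => fderiv ℝ f (ξ + s • y)) s) z
    rw [h1, h3, Pi.smul_apply, fderiv_comp_add_smul]
  simp only [h2, _root_.smul_apply, ← Finset.smul_sum, hz, smul_zero]

variable [MeasurableSpace E] [BorelSpace E]

/-- The weighted `L²` pairing on the unit ball of the dilates of `u` about `ξ` by `s` and `t`. -/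
noncomputable def dilationPairing (u : E → ℝ) (ξ : E) (s t : ℝ) : ℝ :=
  ∫ y in Metric.closedBall (0 : E) 1, unitBallWeight y * (u (ξ + s • y) * u (ξ + t • y))

theorem integrableOn_dilationPairing_integrand (hu : ContinuousOn u (Metric.ball ξ R)) {s t : ℝ}
    (hs : 0 ≤ s) (hsR : s < R) (ht : 0 ≤ t) (htR : t < R) :
    IntegrableOn (fun y => unitBallWeight y * (u (ξ + s • y) * u (ξ + t • y)))
      (Metric.closedBall 0 1) :=
  (continuousOn_dilationPairing_integrand hu hs hsR ht htR).integrableOn_compact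
    (isCompact_closedBall 0 1)

/-- The pairing of two dilates of a harmonic function only depends on the product of the
dilation factors. -/
theorem dilationPairing_eq_of_mul_eq
    (hu : InnerProductSpace.HarmonicOnNhd u (Metric.ball ξ R)) {a b a' b' : ℝ}
    (ha : 0 < a) (haR : a < R) (ha' : 0 < a') (haR' : a' < R)
    (hb : 0 < b) (hbR : b < R) (hb' : 0 < b') (hbR' : b' < R) (h : a * b = a' * b') :
    dilationPairing u ξ a b = dilationPairing u ξ a' b' := by
  have hR : 0 < R := ha.trans haR
  set p := a * b with hp
  have hp0 : 0 < p := mul_pos ha hb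
  -- The positive `s` for which both `s` and `p / s` are below `R`; an interval, so a zero
  -- derivative forces constancy.
  let S := Ioo (p / R) R
  have hS : ∀ s ∈ S, 0 < s ∧ s < R ∧ 0 < p / s ∧ p / s < R := by
    intro s hs
    have h0 : 0 < s := (div_pos hp0 hR).trans hs.1
    refine ⟨h0, hs.2, div_pos hp0 h0, ?_⟩
    rw [div_lt_iff₀ h0, mul_comm]
    exact (div_lt_iff₀ hR).1 hs.1
  have huc : ContinuousOn u (Metric.ball ξ R) := hu.contDiffOn.continuousOn
  have hduc : ContinuousOn (fderiv ℝ u) (Metric.ball ξ R) :=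
    hu.contDiffOn.continuousOn_fderiv_of_isOpen Metric.isOpen_ball (by norm_num)
  let F : ℝ → E → ℝ := fun s y => unitBallWeight y * (u (ξ + s • y) * u (ξ + (p / s) • y))
  let F' : ℝ → E → ℝ := fun s y => unitBallWeight y *
    (fderiv ℝ u (ξ + s • y) y * u (ξ + (p / s) • y) +
      u (ξ + s • y) * (-p / s ^ 2 * fderiv ℝ u (ξ + (p / s) • y) y))
  have hd : ∀ s ∈ S, ∀ y ∈ Metric.closedBall (0 : E) 1,
      HasDerivAt (fun t => F t y) (F' s y) s := by
    intro s hs y hy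
    obtain ⟨h1, h2, h3, h4⟩ := hS s hs
    have hy' : ‖y‖ ≤ 1 := by simpa using hy
    have d1 : HasDerivAt (fun t : ℝ => u (ξ + t • y)) (fderiv ℝ u (ξ + s • y) y) s := by
      have := ((hu _ (add_smul_mem_ball h1.le h2 hy')).1.differentiableAt
        two_ne_zero).hasFDerivAt.comp_hasDerivAt s
        (((hasDerivAt_id s).smul_const y).const_add ξ)
      refine this.congr_deriv ?_
      simp
    have d2 : HasDerivAt (fun t : ℝ => u (ξ + (p / t) • y))
        (-p / s ^ 2 * fderiv ℝ u (ξ + (p / s) • y) y) s := by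
      have hi : HasDerivAt (fun t : ℝ => p / t) (-p / s ^ 2) s := by
        have := (hasDerivAt_const s p).div (hasDerivAt_id s) h1.ne'
        refine this.congr_deriv ?_
        simp
      have := ((hu _ (add_smul_mem_ball h3.le h4 hy')).1.differentiableAt
        two_ne_zero).hasFDerivAt.comp_hasDerivAt s ((hi.smul_const y).const_add ξ)
      refine this.congr_deriv ?_
      simp
    exact (d1.mul d2).const_mul _
  have hF' : ContinuousOn (Function.uncurry F') (S ×ˢ Metric.closedBall (0 : E) 1) := by
    have m1 : MapsTo (fun q : ℝ × E => ξ + q.1 • q.2) (S ×ˢ Metric.closedBall (0 : E) 1)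
        (Metric.ball ξ R) := fun q hq =>
      add_smul_mem_ball (hS _ hq.1).1.le (hS _ hq.1).2.1 (by simpa using hq.2)
    have m2 : MapsTo (fun q : ℝ × E => ξ + (p / q.1) • q.2) (S ×ˢ Metric.closedBall (0 : E) 1)
        (Metric.ball ξ R) := fun q hq =>
      add_smul_mem_ball (hS _ hq.1).2.2.1.le (hS _ hq.1).2.2.2 (by simpa using hq.2)
    have hne : ∀ q ∈ S ×ˢ Metric.closedBall (0 : E) 1, q.1 ≠ 0 := fun q hq => (hS _ hq.1).1.ne'
    have c1 : ContinuousOn (fun q : ℝ × E => ξ + q.1 • q.2) (S ×ˢ Metric.closedBall (0 : E) 1) :=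
      by fun_prop
    have c3 : ContinuousOn (fun q : ℝ × E => p / q.1) (S ×ˢ Metric.closedBall (0 : E) 1) :=
      continuousOn_const.div continuousOn_fst hne
    have c4 : ContinuousOn (fun q : ℝ × E => -p / q.1 ^ 2) (S ×ˢ Metric.closedBall (0 : E) 1) :=
      continuousOn_const.div (continuousOn_fst.pow 2) fun q hq => pow_ne_zero 2 (hne q hq)
    have c2 : ContinuousOn (fun q : ℝ × E => ξ + (p / q.1) • q.2)
        (S ×ˢ Metric.closedBall (0 : E) 1) :=
      continuousOn_const.add (c3.smul continuousOn_snd)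
    exact (continuous_unitBallWeight.comp continuous_snd).continuousOn.mul
      ((((hduc.comp c1 m1).clm_apply continuousOn_snd).mul (huc.comp c2 m2)).add
        ((huc.comp c1 m1).mul (c4.mul ((hduc.comp c2 m2).clm_apply continuousOn_snd))))
  have hD : ∀ s ∈ S, HasDerivAt (fun t => dilationPairing u ξ t (p / t)) 0 s := by
    intro s hs
    obtain ⟨h1, h2, h3, h4⟩ := hS s hs
    have key := hasDerivAt_setIntegral_of_isCompact (isCompact_closedBall (0 : E) 1)
      (isOpen_Ioo : IsOpen S) (F := F) (F' := F')
      (fun t ht => continuousOn_dilationPairing_integrand huc (hS t ht).1.le (hS t ht).2.1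
        (hS t ht).2.2.1.le (hS t ht).2.2.2) hF' hd hs
    refine key.congr_deriv ?_
    have hg := integral_unitBallWeight_mul_radial_eq_zero (E := E)
      (f := fun y => u (ξ + s • y)) (g := fun y => u (ξ + (p / s) • y))
      (ρ := min (R / s) (R / (p / s)))
      (lt_min ((one_lt_div h1).2 h2) ((one_lt_div h3).2 h4))
      (fun y hy => by
        refine (hu _ ?_).comp_add_smul
        have := (mem_ball_zero_iff.1 hy).trans_le (min_le_left _ _)
        rw [Metric.mem_ball, dist_eq_norm, add_sub_cancel_left, norm_smul,
          Real.norm_of_nonneg h1.le, mul_comm]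
        exact (lt_div_iff₀ h1).1 this)
      (fun y hy => by
        refine (hu _ ?_).comp_add_smul
        have := (mem_ball_zero_iff.1 hy).trans_le (min_le_right _ _)
        rw [Metric.mem_ball, dist_eq_norm, add_sub_cancel_left, norm_smul,
          Real.norm_of_nonneg h3.le, mul_comm]
        exact (lt_div_iff₀ h3).1 this)
    simp only [fderiv_comp_add_smul, _root_.smul_apply, smul_eq_mul] at hg
    -- Since `d(p/s)/ds = -(p/s)/s`, differentiating in `s` is `1/s` times the difference of the
    -- radial derivatives of the two dilates, the integrand of Green's identity.
    have : ∀ y, F' s y = s⁻¹ * (unitBallWeight y * (u (ξ + (p / s) • y) *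
        (s * fderiv ℝ u (ξ + s • y) y) -
          u (ξ + s • y) * (p / s * fderiv ℝ u (ξ + (p / s) • y) y))) := by
      intro y
      simp only [F']
      field_simp
      ring
    simp_rw [this]
    rw [integral_const_mul, hg, mul_zero]
  have hmem : ∀ c d : ℝ, 0 < c → c < R → d < R → c * d = p → c ∈ S := by
    intro c d hc hcR hdR hcd
    refine ⟨?_, hcR⟩
    rw [div_lt_iff₀ hR, ← hcd]
    exact mul_lt_mul_of_pos_left hdR hc
  have := (isOpen_Ioo : IsOpen S).is_const_of_deriv_eq_zero isPreconnected_Ioo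
    (f := fun t => dilationPairing u ξ t (p / t))
    (fun s hs => (hD s hs).differentiableAt.differentiableWithinAt) (fun s hs => (hD s hs).deriv)
    (hmem a b ha haR hbR rfl) (hmem a' b' ha' haR' hbR' h.symm)
  have e1 : p / a = b := by rw [hp]; field_simp
  have e2 : p / a' = b' := by rw [h]; field_simp
  simpa [e1, e2] using this

/-- Cauchy–Schwarz, from the discriminant of a nonnegative quadratic. -/
theorem dilationPairing_sq_le (hu : ContinuousOn u (Metric.ball ξ R)) {s t : ℝ}
    (hs : 0 ≤ s) (hsR : s < R) (ht : 0 ≤ t) (htR : t < R) :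
    dilationPairing u ξ s t ^ 2 ≤ dilationPairing u ξ s s * dilationPairing u ξ t t := by
  have i1 := integrableOn_dilationPairing_integrand hu hs hsR hs hsR
  have i2 := integrableOn_dilationPairing_integrand hu hs hsR ht htR
  have i3 := integrableOn_dilationPairing_integrand hu ht htR ht htR
  have hq : ∀ x : ℝ, 0 ≤ dilationPairing u ξ s s * (x * x) + 2 * dilationPairing u ξ s t * x +
      dilationPairing u ξ t t := by
    intro x
    have : dilationPairing u ξ s s * (x * x) + 2 * dilationPairing u ξ s t * x +
        dilationPairing u ξ t t = ∫ y in Metric.closedBall (0 : E) 1,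
          unitBallWeight y * (x * u (ξ + s • y) + u (ξ + t • y)) ^ 2 := by
      unfold dilationPairing
      rw [← integral_mul_const, ← integral_const_mul, ← integral_mul_const, ← integral_add,
        ← integral_add]
      · exact integral_congr_ae (Eventually.of_forall fun y => by ring)
      · exact (i1.mul_const _).add ((i2.const_mul _).mul_const _)
      · exact i3
      · exact i1.mul_const _
      · exact (i2.const_mul _).mul_const _
    rw [this]
    exact integral_nonneg fun y => mul_nonneg (unitBallWeight_nonneg y) (sq_nonneg _)
  have := discrim_le_zero hq
  rw [discrim] at this
  nlinarith

/-- Both `(2r, 2r)` and `(r, 4r)` have product `4r²`, so their pairings agree and Cauchy–Schwarz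
applies to the second. -/
theorem dilationPairing_two_mul_sq_le
    (hu : InnerProductSpace.HarmonicOnNhd u (Metric.ball ξ R)) {r : ℝ} (hr : 0 < r)
    (hrR : 4 * r < R) :
    dilationPairing u ξ (2 * r) (2 * r) ^ 2 ≤
      dilationPairing u ξ r r * dilationPairing u ξ (4 * r) (4 * r) := by
  rw [dilationPairing_eq_of_mul_eq hu (a' := r) (b' := 4 * r) (by linarith) (by linarith) hr
    (by linarith) (by linarith) (by linarith) (by linarith) hrR (by ring)]
  exact dilationPairing_sq_le hu.contDiffOn.continuousOn hr.le (by linarith) (by linarith) hrR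

end Pairing

theorem exists_half_lt_two_pow_mul_le {r A : ℝ} (hr : 0 < r) (hrA : r ≤ A) :
    ∃ k : ℕ, A / 2 < 2 ^ k * r ∧ 2 ^ k * r ≤ A := by
  obtain ⟨k, h1, h2⟩ := exists_nat_pow_near ((one_le_div hr).2 hrA) one_lt_two
  rw [le_div_iff₀ hr] at h1
  rw [div_lt_iff₀ hr, pow_succ] at h2
  exact ⟨k, by linarith, h1⟩

/-! ### Comparison with the square mass, unique continuation, doubling -/

section UniqueContinuation

variable {E : Type*} [NormedAddCommGroup E] [InnerProductSpace ℝ E] [FiniteDimensional ℝ E]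
  [MeasurableSpace E] [BorelSpace E] {u : E → ℝ} {ξ : E} {R : ℝ}

theorem eqOn_zero_of_setIntegral_sq_eq_zero {U : Set E} (hU : IsOpen U) (hu : ContinuousOn u U)
    (hi : IntegrableOn (fun x => u x ^ 2) U) (h : ∫ x in U, u x ^ 2 = 0) : EqOn u 0 U := by
  rw [setIntegral_eq_zero_iff_of_nonneg_ae (Eventually.of_forall fun x => sq_nonneg _) hi] at h
  refine Measure.eqOn_open_of_ae_eq (μ := volume) ?_ hU hu continuousOn_const
  filter_upwards [h] with x hx
  simpa using hx

theorem setIntegral_ball_comp_add_smul (f : E → ℝ) (ξ : E) {s : ℝ} (hs : 0 < s) (ρ : ℝ) :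
    ∫ y in Metric.ball (0 : E) ρ, f (ξ + s • y) =
      (s ^ Module.finrank ℝ E)⁻¹ * ∫ x in Metric.ball ξ (s * ρ), f x := by
  rw [Measure.setIntegral_comp_smul_of_pos volume (fun z => f (ξ + z)) _ hs, smul_eq_mul,
    smul_ball hs.ne', smul_zero, Real.norm_of_nonneg hs.le,
    ← (measurePreserving_add_left volume ξ).setIntegral_preimage_emb
      (measurableEmbedding_addLeft ξ) f]
  simp

theorem integrableOn_sq_ball (hu : ContinuousOn u (Metric.ball ξ R)) {r : ℝ} (hr : r < R) :
    IntegrableOn (fun x => u x ^ 2) (Metric.ball ξ r) :=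
  (((hu.mono (Metric.closedBall_subset_ball hr)).pow 2).integrableOn_compact
    (isCompact_closedBall ξ r)).mono_set Metric.ball_subset_closedBall

theorem dilationPairing_self_eq_ball (u : E → ℝ) (ξ : E) (s : ℝ) :
    dilationPairing u ξ s s =
      ∫ y in Metric.ball (0 : E) 1, unitBallWeight y * u (ξ + s • y) ^ 2 := by
  unfold dilationPairing
  simp_rw [← pow_two]
  refine setIntegral_eq_of_subset_of_forall_sdiff_eq_zero Metric.isClosed_closedBall.measurableSet
    Metric.ball_subset_closedBall fun y hy => ?_
  rw [unitBallWeight_eq_zero (by simpa using hy.2), zero_mul]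

theorem integrableOn_comp_add_smul_sq (hu : ContinuousOn u (Metric.ball ξ R)) {s : ℝ}
    (hs : 0 ≤ s) (hsR : s < R) :
    IntegrableOn (fun y => u (ξ + s • y) ^ 2) (Metric.closedBall (0 : E) 1) :=
  ((hu.comp_add_smul_closedBall hs hsR).pow 2).integrableOn_compact (isCompact_closedBall 0 1)

theorem integrableOn_unitBallWeight_mul_sq (hu : ContinuousOn u (Metric.ball ξ R)) {s : ℝ}
    (hs : 0 ≤ s) (hsR : s < R) :
    IntegrableOn (fun y => unitBallWeight y * u (ξ + s • y) ^ 2) (Metric.closedBall (0 : E) 1) := by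
  simpa only [pow_two] using integrableOn_dilationPairing_integrand hu hs hsR hs hsR

theorem dilationPairing_self_le (hu : ContinuousOn u (Metric.ball ξ R)) {s : ℝ}
    (hs : 0 < s) (hsR : s < R) :
    dilationPairing u ξ s s ≤
      (s ^ Module.finrank ℝ E)⁻¹ * ∫ x in Metric.ball ξ s, u x ^ 2 := by
  have h := setIntegral_ball_comp_add_smul (fun x => u x ^ 2) ξ hs 1
  rw [mul_one] at h
  rw [← h, dilationPairing_self_eq_ball]
  refine setIntegral_mono
    ((integrableOn_unitBallWeight_mul_sq hu hs.le hsR).mono_set Metric.ball_subset_closedBall)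
    ((integrableOn_comp_add_smul_sq hu hs.le hsR).mono_set Metric.ball_subset_closedBall)
    fun y => ?_
  have : unitBallWeight y ≤ 1 := max_le zero_le_one (by linarith [sq_nonneg ‖y‖])
  exact mul_le_of_le_one_left (sq_nonneg _) this

/-- The weight is at least `3/4` on the ball of radius `1/2`. -/
theorem le_dilationPairing_self (hu : ContinuousOn u (Metric.ball ξ R)) {s : ℝ}
    (hs : 0 < s) (hsR : s < R) :
    3 / 4 * ((s ^ Module.finrank ℝ E)⁻¹ * ∫ x in Metric.ball ξ (s / 2), u x ^ 2) ≤
      dilationPairing u ξ s s := by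
  have h := setIntegral_ball_comp_add_smul (fun x => u x ^ 2) ξ hs (1 / 2)
  rw [mul_one_div] at h
  have hsub : Metric.ball (0 : E) (1 / 2) ⊆ Metric.ball 0 1 := Metric.ball_subset_ball (by norm_num)
  have hw := (integrableOn_unitBallWeight_mul_sq hu hs.le hsR).mono_set
    Metric.ball_subset_closedBall
  rw [← h, dilationPairing_self_eq_ball, ← integral_const_mul]
  refine (setIntegral_mono_on ?_ (hw.mono_set hsub) Metric.isOpen_ball.measurableSet
    fun y hy => ?_).trans (setIntegral_mono_set hw (Eventually.of_forall fun y =>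
      mul_nonneg (unitBallWeight_nonneg y) (sq_nonneg _)) hsub.eventuallyLE)
  · exact ((integrableOn_comp_add_smul_sq hu hs.le hsR).mono_set
      (hsub.trans Metric.ball_subset_closedBall)).const_mul _
  · have hy' : ‖y‖ < 1 / 2 := by simpa using hy
    have : 3 / 4 ≤ unitBallWeight y := le_max_of_le_right (by nlinarith [norm_nonneg y])
    exact mul_le_mul_of_nonneg_right this (sq_nonneg _)

theorem eqOn_zero_ball_of_dilationPairing_self_eq_zero (hu : ContinuousOn u (Metric.ball ξ R))
    {s : ℝ} (hs : 0 < s) (hsR : s < R) (h : dilationPairing u ξ s s = 0) :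
    EqOn u 0 (Metric.ball ξ s) := by
  rw [dilationPairing_self_eq_ball, setIntegral_eq_zero_iff_of_nonneg_ae
    (Eventually.of_forall fun y => mul_nonneg (unitBallWeight_nonneg y) (sq_nonneg _))
    ((integrableOn_unitBallWeight_mul_sq hu hs.le hsR).mono_set
      Metric.ball_subset_closedBall)] at h
  have key : EqOn (fun y => unitBallWeight y * u (ξ + s • y) ^ 2) (fun _ => 0)
      (Metric.ball (0 : E) 1) := by
    refine Measure.eqOn_open_of_ae_eq h Metric.isOpen_ball ?_ continuousOn_const
    exact continuous_unitBallWeight.continuousOn.mul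
      (((hu.comp_add_smul_closedBall hs.le hsR).mono Metric.ball_subset_closedBall).pow 2)
  intro x hx
  have hy : s⁻¹ • (x - ξ) ∈ Metric.ball (0 : E) 1 := by
    rw [mem_ball_zero_iff, norm_smul, norm_inv, Real.norm_of_nonneg hs.le, inv_mul_lt_iff₀ hs,
      mul_one, ← dist_eq_norm]
    exact hx
  have := key hy
  have hpos : 0 < unitBallWeight (s⁻¹ • (x - ξ)) := by
    rw [mem_ball_zero_iff] at hy
    exact lt_max_of_lt_right (by nlinarith [norm_nonneg (s⁻¹ • (x - ξ))])
  simpa [hpos.ne', smul_smul, hs.ne'] using this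

namespace InnerProductSpace.HarmonicOnNhd

theorem eqOn_zero_ball_two_mul (hu : InnerProductSpace.HarmonicOnNhd u (Metric.ball ξ R))
    {r : ℝ} (hr : 0 < r) (hrR : 4 * r < R) (h0 : EqOn u 0 (Metric.ball ξ r)) :
    EqOn u 0 (Metric.ball ξ (2 * r)) := by
  have huc := hu.contDiffOn.continuousOn
  have h1 : dilationPairing u ξ r r = 0 := by
    rw [dilationPairing_self_eq_ball]
    refine setIntegral_eq_zero_of_forall_eq_zero fun y hy => ?_
    have : ξ + r • y ∈ Metric.ball ξ r := by
      rw [Metric.mem_ball, dist_eq_norm, add_sub_cancel_left, norm_smul, Real.norm_of_nonneg hr.le]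
      exact mul_lt_of_lt_one_right hr (by simpa using hy)
    simp [h0 this]
  have h2 := dilationPairing_two_mul_sq_le hu hr hrR
  rw [h1, zero_mul] at h2
  exact eqOn_zero_ball_of_dilationPairing_self_eq_zero huc (by linarith) (by linarith)
    (pow_eq_zero_iff two_ne_zero |>.1 (le_antisymm h2 (sq_nonneg _)))

/-- Repeated doubling reaches a radius independent of `r`, which is what makes the zero set's
interior relatively closed below. -/
theorem eqOn_zero_ball_quarter (hu : InnerProductSpace.HarmonicOnNhd u (Metric.ball ξ R))
    {r : ℝ} (hr : 0 < r) (h0 : EqOn u 0 (Metric.ball ξ r)) :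
    EqOn u 0 (Metric.ball ξ (R / 4)) := by
  rcases le_or_gt (R / 4) r with h | h
  · exact h0.mono (Metric.ball_subset_ball h)
  have hk : ∀ k : ℕ, 2 ^ k * r < R / 2 → EqOn u 0 (Metric.ball ξ (2 ^ k * r)) := by
    intro k
    induction k with
    | zero => intro _; simpa using h0
    | succ k ih =>
      intro hk
      have e : (2 : ℝ) ^ (k + 1) * r = 2 * (2 ^ k * r) := by ring
      have hpos : 0 < 2 ^ k * r := by positivity
      rw [e] at hk ⊢
      exact hu.eqOn_zero_ball_two_mul hpos (by linarith) (ih (by linarith))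
  obtain ⟨k, h1, h2⟩ := exists_half_lt_two_pow_mul_le hr h.le
  have e : (2 : ℝ) ^ (k + 1) * r = 2 * (2 ^ k * r) := by ring
  rcases h2.lt_or_eq with h3 | h3
  · exact (hk (k + 1) (by rw [e]; linarith)).mono (Metric.ball_subset_ball (by rw [e]; linarith))
  · exact (hk k (by linarith)).mono (Metric.ball_subset_ball h3.ge)

/-- Weak unique continuation for harmonic functions. -/
theorem eqOn_zero_of_eventuallyEq_zero {Ω : Set E}
    (hu : InnerProductSpace.HarmonicOnNhd u Ω) (hΩ : IsOpen Ω) (hc : IsPreconnected Ω)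
    (hξ : ξ ∈ Ω) (h0 : u =ᶠ[𝓝 ξ] 0) : EqOn u 0 Ω := by
  have hsub : Ω ⊆ interior {x | u x = 0} := by
    refine hc.subset_of_closure_inter_subset isOpen_interior
      ⟨ξ, hξ, mem_interior_iff_mem_nhds.2 h0⟩ ?_
    rintro x ⟨hx, hxΩ⟩
    obtain ⟨R, hR, hRΩ⟩ := Metric.isOpen_iff.1 hΩ x hxΩ
    -- The ball of radius `R/2` about `z` stays in `Ω`, so `u` vanishes within `R/8` of `z`, a ball
    -- that contains `x`.
    obtain ⟨z, hz, hxz⟩ := Metric.mem_closure_iff.1 hx (R / 8) (by linarith)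
    obtain ⟨r, hr, hrz⟩ := Metric.isOpen_iff.1 isOpen_interior z hz
    have hzR : Metric.ball z (R / 2) ⊆ Ω :=
      (Metric.ball_subset_ball' (by rw [dist_comm]; linarith)).trans hRΩ
    have := eqOn_zero_ball_quarter (u := u) (ξ := z) (R := R / 2) (fun y hy => hu y (hzR hy)) hr
      fun y hy => interior_subset (s := {x | u x = 0}) (hrz hy)
    rw [mem_interior_iff_mem_nhds]
    exact mem_of_superset (Metric.isOpen_ball.mem_nhds
      (Metric.mem_ball.2 (show dist x z < R / 2 / 4 by linarith))) this
  exact fun x hx => interior_subset (s := {x | u x = 0}) (hsub hx)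

/-- The doubling inequality for the square mass of a harmonic function. -/
theorem exists_setIntegral_sq_two_mul_le
    (hu : InnerProductSpace.HarmonicOnNhd u (Metric.ball ξ R)) {R₀ : ℝ} (hR₀ : 0 < R₀)
    (hR : R₀ < R) :
    ∃ C : ℝ, 0 < C ∧ ∀ r : ℝ, 0 < r → r ≤ R₀ / 2 →
      ∫ x in Metric.ball ξ (2 * r), u x ^ 2 ≤ C * ∫ x in Metric.ball ξ r, u x ^ 2 := by
  have huc := hu.contDiffOn.continuousOn
  set M : ℝ → ℝ := fun r => ∫ x in Metric.ball ξ r, u x ^ 2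
  set h : ℝ → ℝ := fun r => dilationPairing u ξ r r
  set n := Module.finrank ℝ E
  -- The constants below divide by masses. If one vanishes, weak unique continuation gives `u = 0`
  -- on the whole ball.
  by_cases hz : ∃ r, 0 < r ∧ r < R ∧ M r = 0
  · obtain ⟨r, hr, hrR, hMr⟩ := hz
    have h0 := eqOn_zero_of_setIntegral_sq_eq_zero Metric.isOpen_ball
      (huc.mono (Metric.ball_subset_ball hrR.le)) (integrableOn_sq_ball huc hrR) hMr
    have hall := hu.eqOn_zero_of_eventuallyEq_zero Metric.isOpen_ball
      (convex_ball ξ R).isPreconnected (Metric.mem_ball_self (hR₀.trans hR))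
      (mem_of_superset (Metric.ball_mem_nhds ξ hr) h0)
    have hM : ∀ s, s ≤ R₀ → M s = 0 := fun s hs =>
      setIntegral_eq_zero_of_forall_eq_zero fun x hx => by
        simp [hall (Metric.ball_subset_ball (hs.trans hR.le) hx)]
    refine ⟨1, one_pos, fun s hs hsR => ?_⟩
    show M (2 * s) ≤ 1 * M s
    rw [hM _ (by linarith), hM s (by linarith), mul_zero]
  have hM0 : ∀ r, 0 ≤ M r := fun r => integral_nonneg fun x => sq_nonneg _
  have hMpos : ∀ r, 0 < r → r < R → 0 < M r := fun r hr hrR =>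
    (hM0 r).lt_of_ne fun e => hz ⟨r, hr, hrR, e.symm⟩
  have hMmono : ∀ r s, r ≤ s → s < R → M r ≤ M s := fun r s hrs hs =>
    setIntegral_mono_set (integrableOn_sq_ball huc hs) (Eventually.of_forall fun x => sq_nonneg _)
      (Metric.ball_subset_ball hrs).eventuallyLE
  have hhM : ∀ r, 0 < r → r < R → h r ≤ (r ^ n)⁻¹ * M r := fun r hr hrR =>
    dilationPairing_self_le huc hr hrR
  have hMh : ∀ r, 0 < r → r < R → 3 / 4 * ((r ^ n)⁻¹ * M (r / 2)) ≤ h r := fun r hr hrR =>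
    le_dilationPairing_self huc hr hrR
  have hhpos : ∀ r, 0 < r → r < R → 0 < h r := fun r hr hrR =>
    lt_of_lt_of_le (by have := hMpos (r / 2) (by linarith) (by linarith); positivity)
      (hMh r hr hrR)
  have hm8 := hMpos (R₀ / 8) (by linarith) (by linarith)
  have hm4 := hMpos (R₀ / 4) (by linarith) (by linarith)
  have hmR := hMpos R₀ hR₀ hR
  -- Bounds `h(2r)/h(r)` on the top range `R₀/4 < r ≤ R₀/2`, where `2r ≤ R₀` and `r/2 ≥ R₀/8`. The
  -- induction carries the bound down dyadically by log-convexity.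
  set Q := 4 / 3 * (M R₀ / M (R₀ / 8)) with hQ
  have hQ0 : 0 < Q := by positivity
  have hstep : ∀ k : ℕ, ∀ r, 0 < r → R₀ / 2 / 2 < 2 ^ k * r → 2 ^ k * r ≤ R₀ / 2 →
      h (2 * r) ≤ Q * h r := by
    intro k
    induction k with
    | zero =>
      intro r hr h1 h2
      rw [pow_zero, one_mul] at h1 h2
      calc h (2 * r) ≤ ((2 * r) ^ n)⁻¹ * M (2 * r) := hhM _ (by linarith) (by linarith)
        _ ≤ (r ^ n)⁻¹ * M R₀ := by
          refine mul_le_mul ?_ (hMmono _ _ (by linarith) hR) (hM0 _) (by positivity)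
          exact inv_anti₀ (by positivity) (pow_le_pow_left₀ hr.le (by linarith) n)
        _ = Q * (3 / 4 * ((r ^ n)⁻¹ * M (R₀ / 8))) := by
          rw [hQ]; field_simp
        _ ≤ Q * (3 / 4 * ((r ^ n)⁻¹ * M (r / 2))) := by
          have := hMmono (R₀ / 8) (r / 2) (by linarith) (by linarith)
          gcongr
        _ ≤ Q * h r := by
          have := hMh r hr (by linarith)
          gcongr
    | succ k ih =>
      intro r hr h1 h2
      have e : (2 : ℝ) ^ (k + 1) * r = 2 ^ k * (2 * r) := by ring
      rw [e] at h1 h2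
      have h3 := ih (2 * r) (by linarith) h1 h2
      have h4 : 2 * r ≤ 2 ^ k * (2 * r) :=
        le_mul_of_one_le_left (by linarith) (one_le_pow₀ one_le_two)
      have h5 := dilationPairing_two_mul_sq_le hu hr (by linarith)
      rw [show 2 * (2 * r) = 4 * r by ring] at h3
      have h6 := hhpos r hr (by linarith)
      have h7 := hhpos (2 * r) (by linarith) (by linarith)
      refine le_of_mul_le_mul_right ?_ h7
      calc h (2 * r) * h (2 * r) = h (2 * r) ^ 2 := by ring
        _ ≤ h r * h (4 * r) := h5
        _ ≤ h r * (Q * h (2 * r)) := by gcongr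
        _ = Q * h r * h (2 * r) := by ring
  have hdouble : ∀ r, 0 < r → r ≤ R₀ / 2 → h (2 * r) ≤ Q * h r := by
    intro r hr hrR
    obtain ⟨k, h1, h2⟩ := exists_half_lt_two_pow_mul_le hr hrR
    exact hstep k r hr h1 h2
  -- The first summand serves `r ≤ R₀/4`: bounding `M(2r)` by `h` costs a factor two in radius, so
  -- `h(4r)` is needed and doubling is used twice. The second serves `r > R₀/4`, by monotonicity of
  -- `M`.
  refine ⟨4 / 3 * 4 ^ n * Q ^ 2 + M R₀ / M (R₀ / 4), by positivity, fun r hr hrR => ?_⟩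
  show M (2 * r) ≤ _ * M r
  rw [add_mul]
  rcases le_or_gt r (R₀ / 4) with hr4 | hr4
  · refine le_add_of_le_of_nonneg ?_ (mul_nonneg (by positivity) (hM0 r))
    have h1 := hMh (4 * r) (by linarith) (by linarith)
    rw [show 4 * r / 2 = 2 * r by ring] at h1
    have h2 : h (4 * r) ≤ Q ^ 2 * ((r ^ n)⁻¹ * M r) := by
      calc h (4 * r) = h (2 * (2 * r)) := by ring_nf
        _ ≤ Q * h (2 * r) := hdouble _ (by linarith) (by linarith)
        _ ≤ Q * (Q * h r) := by gcongr; exact hdouble r hr hrR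
        _ = Q ^ 2 * h r := by ring
        _ ≤ Q ^ 2 * ((r ^ n)⁻¹ * M r) := by gcongr; exact hhM r hr (by linarith)
    calc M (2 * r) = 4 / 3 * (4 * r) ^ n * (3 / 4 * (((4 * r) ^ n)⁻¹ * M (2 * r))) := by
          field_simp
      _ ≤ 4 / 3 * (4 * r) ^ n * (Q ^ 2 * ((r ^ n)⁻¹ * M r)) := by
          exact mul_le_mul_of_nonneg_left (h1.trans h2) (by positivity)
      _ = 4 / 3 * 4 ^ n * Q ^ 2 * M r := by
          rw [mul_pow]; field_simp
  · refine le_add_of_nonneg_of_le (mul_nonneg (by positivity) (hM0 r)) ?_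
    calc M (2 * r) ≤ M R₀ := hMmono _ _ (by linarith) hR
      _ = M R₀ / M (R₀ / 4) * M (R₀ / 4) := by field_simp
      _ ≤ M R₀ / M (R₀ / 4) * M r := by
        have := hMmono (R₀ / 4) r hr4.le (by linarith)
        gcongr

/-- Strong unique continuation for harmonic functions. -/
theorem eqOn_zero_of_isBigO_pow {Ω : Set E} (hu : InnerProductSpace.HarmonicOnNhd u Ω)
    (hΩ : IsOpen Ω) (hc : IsPreconnected Ω) (hξ : ξ ∈ Ω)
    (hv : ∀ N : ℕ, (fun r : ℝ => ∫ x in Metric.ball ξ r, u x ^ 2) =O[𝓝[>] 0] fun r => r ^ N) :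
    EqOn u 0 Ω := by
  obtain ⟨R, hR, hRΩ⟩ := Metric.isOpen_iff.1 hΩ ξ hξ
  have huR : InnerProductSpace.HarmonicOnNhd u (Metric.ball ξ R) := fun y hy => hu y (hRΩ hy)
  have huc := huR.contDiffOn.continuousOn
  obtain ⟨C, hC, hdouble⟩ := huR.exists_setIntegral_sq_two_mul_le (half_pos hR) (half_lt_self hR)
  set M : ℝ → ℝ := fun r => ∫ x in Metric.ball ξ r, u x ^ 2
  set ρ := R / 2 with hρ
  have hρ0 : 0 < ρ := half_pos hR
  have hiter : ∀ k : ℕ, M ρ ≤ C ^ k * M (ρ / 2 ^ k) := by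
    intro k
    induction k with
    | zero => simp
    | succ k ih =>
      have h1 : (1 : ℝ) ≤ 2 ^ k := one_le_pow₀ one_le_two
      have h2 : ρ / 2 ^ (k + 1) ≤ ρ / 2 := by
        gcongr
        exact le_self_pow₀ one_le_two (by simp)
      have h3 := hdouble (ρ / 2 ^ (k + 1)) (by positivity) h2
      rw [show 2 * (ρ / 2 ^ (k + 1)) = ρ / 2 ^ k by rw [pow_succ]; field_simp] at h3
      calc M ρ ≤ C ^ k * M (ρ / 2 ^ k) := ih
        _ ≤ C ^ k * (C * M (ρ / 2 ^ (k + 1))) := by gcongr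
        _ = C ^ (k + 1) * M (ρ / 2 ^ (k + 1)) := by ring
  -- With `C < 2^N`, the bound `C^k A (ρ/2^k)^N` is geometric of ratio `C/2^N < 1`.
  obtain ⟨N, hN⟩ := pow_unbounded_of_one_lt C one_lt_two
  obtain ⟨A, hA⟩ := (hv N).bound
  have hlim : Tendsto (fun k : ℕ => ρ / 2 ^ k) atTop (𝓝[>] (0 : ℝ)) := by
    refine tendsto_nhdsWithin_iff.2 ⟨?_, Eventually.of_forall fun k => ?_⟩
    · simpa [div_eq_mul_inv] using
        (tendsto_pow_atTop_nhds_zero_of_lt_one (r := (2 : ℝ)⁻¹) (by norm_num)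
          (by norm_num)).const_mul ρ
    · exact mem_Ioi.2 (by positivity)
  have hgeom : Tendsto (fun k : ℕ => A * ρ ^ N * (C / 2 ^ N) ^ k) atTop (𝓝 0) := by
    simpa using (tendsto_pow_atTop_nhds_zero_of_lt_one (r := C / 2 ^ N) (by positivity)
      ((div_lt_one (by positivity)).2 hN)).const_mul (A * ρ ^ N)
  have hle : M ρ ≤ 0 := by
    refine ge_of_tendsto hgeom ?_
    filter_upwards [hlim.eventually hA] with k hk
    have h1 : M (ρ / 2 ^ k) ≤ A * (ρ / 2 ^ k) ^ N := by
      refine (Real.le_norm_self _).trans (hk.trans_eq ?_)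
      rw [Real.norm_of_nonneg (by positivity)]
    calc M ρ ≤ C ^ k * M (ρ / 2 ^ k) := hiter k
      _ ≤ C ^ k * (A * (ρ / 2 ^ k) ^ N) := by gcongr
      _ = A * ρ ^ N * (C / 2 ^ N) ^ k := by
        rw [div_pow ρ, div_pow C, pow_right_comm (2 : ℝ) k N]; ring
  have hM : M ρ = 0 := le_antisymm hle (integral_nonneg fun x => sq_nonneg _)
  have hρR : ρ < R := half_lt_self hR
  have h0 := eqOn_zero_of_setIntegral_sq_eq_zero Metric.isOpen_ball
    (huc.mono (Metric.ball_subset_ball hρR.le)) (integrableOn_sq_ball huc hρR) hM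
  exact hu.eqOn_zero_of_eventuallyEq_zero hΩ hc hξ
    (mem_of_superset (Metric.ball_mem_nhds ξ hρ0) h0)

end InnerProductSpace.HarmonicOnNhd

end UniqueContinuation

/-! ### Passage to the distance to the boundary and to `L²` norms -/

/-- The ball is connected, meets `Ω` and misses its frontier, so it cannot leave `Ω`. -/
theorem ball_infDist_frontier_subset {E : Type*} [NormedAddCommGroup E] [NormedSpace ℝ E]
    {Ω : Set E} {ξ : E} (hΩ : IsOpen Ω) (hξ : ξ ∈ Ω) :
    Metric.ball ξ (Metric.infDist ξ (frontier Ω)) ⊆ Ω := by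
  intro x hx
  have hpos : 0 < Metric.infDist ξ (frontier Ω) := dist_nonneg.trans_lt hx
  refine (convex_ball ξ _).isPreconnected.subset_of_closure_inter_subset hΩ
    ⟨ξ, Metric.mem_ball_self hpos, hξ⟩ ?_ hx
  rintro y ⟨hy, hyb⟩
  by_contra hyΩ
  exact disjoint_left.1 Metric.disjoint_ball_infDist hyb ⟨hy, by rwa [hΩ.interior_eq]⟩

theorem eLpNorm_two_restrict_eq {X : Type*} [MeasurableSpace X] {μ : Measure X} {f : X → ℝ}
    {s : Set X} (hm : AEStronglyMeasurable f (μ.restrict s))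
    (hi : IntegrableOn (fun x => f x ^ 2) s μ) :
    eLpNorm f 2 (μ.restrict s) = ENNReal.ofReal (√(∫ x in s, f x ^ 2 ∂μ)) := by
  have hL : MemLp f 2 (μ.restrict s) := (memLp_two_iff_integrable_sq hm).2 hi
  rw [hL.eLpNorm_eq_integral_rpow_norm two_ne_zero ENNReal.ofNat_ne_top]
  simp [Real.sqrt_eq_rpow]

theorem mainTheorem11 (n : ℕ) (hn : 2 ≤ n)
    (Ω : Set (EuclideanSpace ℝ (Fin n)))
    (hΩ_open : IsOpen Ω) (hΩ_conn : IsConnected Ω) (hΩ_bdd : Bornology.IsBounded Ω)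
    (u : EuclideanSpace ℝ (Fin n) → ℝ) (hu : InnerProductSpace.HarmonicOnNhd u Ω) :
    (∀ ξ ∈ Ω, ∀ rbar : ℝ, 0 < rbar → rbar < Metric.infDist ξ (frontier Ω) →
      ∃ C : ℝ, 0 < C ∧ ∀ r : ℝ, 0 < r → r ≤ rbar / 2 →
        eLpNorm u 2 (volume.restrict (Metric.ball ξ (2 * r))) ≤
          ENNReal.ofReal C * eLpNorm u 2 (volume.restrict (Metric.ball ξ r))) ∧
    (∀ ξ ∈ Ω, VanishesOfInfiniteOrderAt u ξ → ∀ x ∈ Ω, u x = 0) := by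
  refine ⟨fun ξ hξ rbar hr0 hrd => ?_, fun ξ hξ hv => ?_⟩
  · have huR : InnerProductSpace.HarmonicOnNhd u
        (Metric.ball ξ (Metric.infDist ξ (frontier Ω))) :=
      fun y hy => hu y (ball_infDist_frontier_subset hΩ_open hξ hy)
    have huc := huR.contDiffOn.continuousOn
    obtain ⟨C, hC, hdouble⟩ := huR.exists_setIntegral_sq_two_mul_le hr0 hrd
    have hnorm : ∀ s < Metric.infDist ξ (frontier Ω),
        eLpNorm u 2 (volume.restrict (Metric.ball ξ s)) =
          ENNReal.ofReal (√(∫ x in Metric.ball ξ s, u x ^ 2)) := fun s hs =>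
      eLpNorm_two_restrict_eq ((huc.mono (Metric.ball_subset_ball hs.le)).aestronglyMeasurable
        Metric.isOpen_ball.measurableSet) (integrableOn_sq_ball huc hs)
    refine ⟨√C, Real.sqrt_pos.2 hC, fun r hr hrR => ?_⟩
    rw [hnorm _ (by linarith), hnorm _ (by linarith), ← ENNReal.ofReal_mul (Real.sqrt_nonneg _),
      ← Real.sqrt_mul hC.le]
    exact ENNReal.ofReal_le_ofReal (Real.sqrt_le_sqrt (hdouble r hr hrR))
  · exact hu.eqOn_zero_of_isBigO_pow hΩ_open hΩ_conn.isPreconnected hξ hv
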